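/- **Theorem (Front-door reducible adjustment).** Let $\mathcal G$ be an acyclic directed mixed graph (ADMG) on a finite vertex set $V$, let $X,Y\in V$, and let $X^*\ni X$, $Y^*\ni Y$ and $M^*\neq\emptyset$ be pairwise disjoint subsets of $V$ such that * (FDR1) every directed path from a vertex of $X^*$ to a vertex of $Y^*$ meets $M^*$; * (FDR2) $X^*$ and $M^*$ are m-separated by $\emptyset$ in $\mathcal G_{\underline{X^*}}$; * (FDR3) for each $M_i\in M^*$, $Y^*$ and $M_i$ are m-separated by $X^*\cup(M^*\setminus\{M_i\})$ in $\mathcal G_{\overline{X^*}\,\underline{M_i}}$. Here $\mathcal G_{\overline S}$ is $\mathcal G$ without the (directed or bidirected) arcs that have an arrowhead in $S$, and $\mathcal G_{\underline S}$ is $\mathcal G$ without the directed arcs that leave $S$. Consider semi-Markovian structural causal models compatible with $\mathcal G$: each variable $v$ takes values in a countably generated measurable space carrying a $\sigma$-finite reference measure, and is a measurable function of its parents in $\mathcal G$ and a noise $U_v$, where the noises $(U_v)_{v\in A}$ and $(U_v)_{v\in B}$ are independent whenever $A,B\subseteq V$ are disjoint and no bidirected arc joins $A$ to $B$. The intervention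 $do(x^*)$ replaces the mechanisms of $X^*$ by the constants $x^*$. Suppose the observational law of $(X^*,M^*,Y^*)$ has a density $p$ with respect to the product of the reference measures, and let $p(x^*)$, $p(x^*,m^*)$, $p(m^*\mid x^*)$, $p(y^*\mid x^*,m^*)$ be its marginal and conditional densities. Then, for almost every $x^*$ at which the formula below is defined (that is, $p(x^*)\neq 0$, and $p(x'^*,m^*)\neq0$ for almost all $(x'^*,m^*)$ with $p(m^*\mid x^*)\,p(x'^*)\neq 0$; in particular for almost every $x^*$ if the density of $(X^*,M^*)$ is positive almost everywhere), the law of $Y^*$ under $do(x^*)$ has the density $$p(y^*\mid do(x^*))=\int p(y^*\mid x'^*,m^*)\,p(m^*\mid x^*)\,p(x'^*)\,dm^*\,dx'^*.$$ In particular the causal effect of $X^*$ on $Y^*$ is identifiable: for any two such models with the same observational law, the laws of $Y^*$ under $do(x^*)$ coincide for almost every such $x^*$. -/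

import Mathlib

open MeasureTheory ProbabilityTheory
open scoped ENNReal

universe u e w w'

/-! ### Acyclic directed mixed graphs and m-separation -/

/-- An acyclic directed mixed graph on the vertex set `V`. Between two vertices there may be both
a directed and a bidirected arc. -/
structure ADMG (V : Type u) where
  /-- `dir a b` is the arc `a → b`. -/
  dir : V → V → Prop
  /-- `bi a b` is the arc `a ↔ b`. -/
  bi : V → V → Prop
  bi_symm : ∀ a b, bi a b → bi b a
  bi_irrefl : ∀ a, ¬ bi a a
  acyclic : ∀ a, ¬ Relation.TransGen dir a a

/-- The three ways in which an arc can be traversed from `a` to `b`: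
`a → b`, `a ← b` and `a ↔ b`. -/
inductive Arc where
  | fwd
  | bwd
  | bi

/-- The arc, traversed from `a` to `b`, has an arrowhead at `a`. -/
def Arc.HeadAtSource : Arc → Prop
  | .fwd => False
  | .bwd => True
  | .bi => True

/-- The arc, traversed from `a` to `b`, has an arrowhead at `b`. -/
def Arc.HeadAtTarget : Arc → Prop
  | .fwd => True
  | .bwd => False
  | .bi => True

namespace ADMG

variable {V : Type u}

/-- `G` has an arc of the given kind from `a` to `b`. -/
def Has (G : ADMG V) : Arc → V → V → Prop
  | .fwd, a, b => G.dir a b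
  | .bwd, a, b => G.dir b a
  | .bi, a, b => G.bi a b

/-- The ancestors of a set of vertices, the set itself included. -/
def ancestors (G : ADMG V) (Z : Set V) : Set V :=
  {a | ∃ z ∈ Z, Relation.ReflTransGen G.dir a z}

/-- The graph with all arcs incoming to `S` (directed or bidirected) deleted. -/
def deleteIncoming (G : ADMG V) (S : Set V) : ADMG V where
  dir a b := G.dir a b ∧ b ∉ S
  bi a b := G.bi a b ∧ a ∉ S ∧ b ∉ S
  bi_symm a b h := ⟨G.bi_symm a b h.1, h.2.2, h.2.1⟩
  bi_irrefl a h := G.bi_irrefl a h.1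
  acyclic a h := G.acyclic a (Relation.TransGen.mono (fun _ _ h => h.1) _ _ h)

/-- The graph with all arcs outgoing from `S` deleted. -/
def deleteOutgoing (G : ADMG V) (S : Set V) : ADMG V where
  dir a b := G.dir a b ∧ a ∉ S
  bi := G.bi
  bi_symm := G.bi_symm
  bi_irrefl := G.bi_irrefl
  acyclic a h := G.acyclic a (Relation.TransGen.mono (fun _ _ h => h.1) _ _ h)

/-- Walks in the mixed graph. -/
inductive Walk (G : ADMG V) : V → V → Type u where
  | nil (a : V) : Walk G a a
  | cons {a b c : V} (t : Arc) (h : G.Has t a b) (q : Walk G b c) : Walk G a c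

namespace Walk

/-- The vertices of a walk, in order. -/
def support {G : ADMG V} : {a b : V} → G.Walk a b → List V
  | a, _, nil _ => [a]
  | a, _, cons _ _ q => a :: q.support

/-- A path is a walk without repeated vertices. -/
def IsPath {G : ADMG V} {a b : V} (q : G.Walk a b) : Prop := q.support.Nodup

/-- All arcs of the walk are directed and traversed forwards. By acyclicity such a walk is
a path. -/
def IsDirected {G : ADMG V} : {a b : V} → G.Walk a b → Prop
  | _, _, nil _ => True
  | _, _, cons t _ q => t = Arc.fwd ∧ q.IsDirected

/-- The walk is m-connecting given `Z`: each inner vertex that is a collider on the walk is an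
ancestor of `Z`, and no other inner vertex is in `Z`. -/
def IsOpen {G : ADMG V} (Z : Set V) : {a b : V} → G.Walk a b → Prop
  | _, _, nil _ => True
  | _, _, cons _ _ (nil _) => True
  | _, _, cons t _ (cons (a := b) t' h' q) =>
      (t.HeadAtTarget ∧ t'.HeadAtSource → b ∈ G.ancestors Z) ∧
      (¬ (t.HeadAtTarget ∧ t'.HeadAtSource) → b ∉ Z) ∧
      (cons t' h' q).IsOpen Z

end Walk

/-- `A` and `B` are m-separated by `Z` in `G`. -/
def MSep (G : ADMG V) (A B Z : Set V) : Prop :=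
  ∀ a ∈ A, ∀ b ∈ B, ∀ q : G.Walk a b, q.IsPath → ¬ q.IsOpen Z

/-- The front-door reducibility criterion for cause `x` and effect `y`, with super-cause `X`,
super-effect `Y` and super-mediator `M`. -/
structure IsFDRTriple (G : ADMG V) (x y : V) (X Y M : Finset V) : Prop where
  cause_mem : x ∈ X
  effect_mem : y ∈ Y
  mediator_nonempty : M.Nonempty
  disjoint_XY : Disjoint X Y
  disjoint_XM : Disjoint X M
  disjoint_YM : Disjoint Y M
  /-- Every directed path from the super-cause to the super-effect meets the super-mediator. -/
  fdr1 : ∀ i ∈ X, ∀ j ∈ Y, ∀ q : G.Walk i j, q.IsDirected → ∃ v ∈ q.support, v ∈ M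
  fdr2 : (G.deleteOutgoing (X : Set V)).MSep (X : Set V) (M : Set V) ∅
  fdr3 : ∀ i ∈ M, ((G.deleteIncoming (X : Set V)).deleteOutgoing {i}).MSep
    (Y : Set V) {i} ((X : Set V) ∪ ((M : Set V) \ {i}))

/-- The parent relation of an ADMG on a finite vertex set is well-founded. -/
theorem wellFounded_dir [Finite V] (G : ADMG V) : WellFounded G.dir :=
  haveI : Std.Irrefl (Relation.TransGen G.dir) := ⟨G.acyclic⟩
  Subrelation.wf (r := Relation.TransGen G.dir) (fun h => Relation.TransGen.single h)
    (Finite.wellFounded_of_trans_of_irrefl _)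

end ADMG

/-! ### Semi-Markovian structural causal models -/

/-- The values of the variables in `S`. -/
abbrev Vals {V : Type u} (E : V → Type e) (S : Finset V) : Type (max u e) := ∀ v : S, E v

/-- A semi-Markovian structural causal model compatible with the ADMG `G`, whose observed variable
`v` takes values in `E v`. Each `v` is a measurable function of its parents and of an exogenous
noise `U v`; the noises may be dependent, but noises of two sets of vertices without a bidirected
arc between them are independent. -/
structure SCM {V : Type u} (G : ADMG V) (E : V → Type e) [∀ v, MeasurableSpace (E v)] where
  Noise : V → Type w
  [measurableNoise : ∀ v, MeasurableSpace (Noise v)]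
  noiseLaw : Measure (∀ v, Noise v)
  [isProbabilityMeasure : IsProbabilityMeasure noiseLaw]
  noise_indep : ∀ A B : Set V, Disjoint A B → (∀ a ∈ A, ∀ b ∈ B, ¬ G.bi a b) →
    IndepFun (fun n : ∀ v, Noise v => A.domRestrict n) (fun n : ∀ v, Noise v => B.domRestrict n) noiseLaw
  mech : ∀ v, (∀ a : {a // G.dir a v}, E a) → Noise v → E v
  measurable_mech : ∀ v, Measurable (fun z : (∀ a : {a // G.dir a v}, E a) × Noise v =>
    mech v z.1 z.2)

attribute [instance] SCM.measurableNoise SCM.isProbabilityMeasure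

namespace SCM

variable {V : Type u} [Finite V] {G : ADMG V} {E : V → Type e} [∀ v, MeasurableSpace (E v)]

open Classical in
/-- The values of all variables for the noise value `n`, when the mechanisms of the variables in
`S` are replaced by the constants `s`. -/
noncomputable def response (𝓜 : SCM.{u, e, w} G E) (S : Finset V) (s : Vals E S)
    (n : ∀ v, 𝓜.Noise v) : ∀ v, E v :=
  G.wellFounded_dir.fix fun v rec =>
    if h : v ∈ S then s ⟨v, h⟩ else 𝓜.mech v (fun a => rec a.1 a.2) (n v)

/-- The joint law of all observed variables under the intervention `do(S = s)`. -/
noncomputable def doLaw (𝓜 : SCM.{u, e, w} G E) (S : Finset V) (s : Vals E S) :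
    Measure (∀ v, E v) :=
  𝓜.noiseLaw.map (𝓜.response S s)

/-- The observational joint law of all observed variables. -/
noncomputable def obsLaw (𝓜 : SCM.{u, e, w} G E) : Measure (∀ v, E v) :=
  𝓜.doLaw ∅ fun v => absurd v.2 (Finset.notMem_empty _)

end SCM

/-! ### Densities -/

/-- The product reference measure on the values of the variables in `S`. -/
noncomputable def refMeasure {V : Type u} {E : V → Type e} [∀ v, MeasurableSpace (E v)]
    (ν : ∀ v, Measure (E v)) (S : Finset V) : Measure (Vals E S) :=
  Measure.pi fun v : S => ν v

/-- `p` is a joint density of the super-variables `(X, M, Y)` under the observational law of the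
model, with respect to the reference measures `ν`. -/
def SCM.HasObsDensity {V : Type u} [Finite V] {G : ADMG V} {E : V → Type e}
    [∀ v, MeasurableSpace (E v)] (𝓜 : SCM.{u, e, w} G E) (ν : ∀ v, Measure (E v))
    (X M Y : Finset V) (p : Vals E X × Vals E M × Vals E Y → ℝ≥0∞) : Prop :=
  Measurable p ∧
  𝓜.obsLaw.map (fun z => (X.restrict z, M.restrict z, Y.restrict z)) =
    ((refMeasure ν X).prod ((refMeasure ν M).prod (refMeasure ν Y))).withDensity p

namespace FDR

variable {𝒳 ℳ 𝒴 : Type*} [MeasurableSpace 𝒳] [MeasurableSpace ℳ] [MeasurableSpace 𝒴]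

/-- The marginal density `p(x, m)`. -/
noncomputable def densXM (ρY : Measure 𝒴) (p : 𝒳 × ℳ × 𝒴 → ℝ≥0∞) (x : 𝒳) (m : ℳ) : ℝ≥0∞ :=
  ∫⁻ y, p (x, m, y) ∂ρY

/-- The marginal density `p(x)`. -/
noncomputable def densX (ρM : Measure ℳ) (ρY : Measure 𝒴) (p : 𝒳 × ℳ × 𝒴 → ℝ≥0∞) (x : 𝒳) :
    ℝ≥0∞ :=
  ∫⁻ m, densXM ρY p x m ∂ρM

/-- The conditional density `p(m | x)`. -/
noncomputable def condM (ρM : Measure ℳ) (ρY : Measure 𝒴) (p : 𝒳 × ℳ × 𝒴 → ℝ≥0∞)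
    (m : ℳ) (x : 𝒳) : ℝ≥0∞ :=
  densXM ρY p x m / densX ρM ρY p x

/-- The conditional density `p(y | x, m)`. -/
noncomputable def condY (ρY : Measure 𝒴) (p : 𝒳 × ℳ × 𝒴 → ℝ≥0∞) (y : 𝒴) (x : 𝒳) (m : ℳ) :
    ℝ≥0∞ :=
  p (x, m, y) / densXM ρY p x m

/-- The adjustment formula `∫ p(y | x', m) p(m | x) p(x') dm dx'`. -/
noncomputable def adjustment (ρX : Measure 𝒳) (ρM : Measure ℳ) (ρY : Measure 𝒴)
    (p : 𝒳 × ℳ × 𝒴 → ℝ≥0∞) (x : 𝒳) (y : 𝒴) : ℝ≥0∞ :=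
  ∫⁻ x', ∫⁻ m, condY ρY p y x' m * condM ρM ρY p m x * densX ρM ρY p x' ∂ρM ∂ρX

/-- The conditional densities in the adjustment formula at `x` are defined: `p(x) ≠ 0`, and
`p(x', m) ≠ 0` for almost all `(x', m)` with `p(m | x) p(x') ≠ 0`. -/
def Defined (ρX : Measure 𝒳) (ρM : Measure ℳ) (ρY : Measure 𝒴)
    (p : 𝒳 × ℳ × 𝒴 → ℝ≥0∞) (x : 𝒳) : Prop :=
  densX ρM ρY p x ≠ 0 ∧
  ∀ᵐ z ∂ρX.prod ρM, condM ρM ρY p z.2 x * densX ρM ρY p z.1 ≠ 0 → densXM ρY p z.1 z.2 ≠ 0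

end FDR

set_option linter.unusedSectionVars false

/-! ### Countably generated products -/

/-! The graph reduces the model to a front-door model with two independent noises. Let `A` be the
set of ancestors of `M` along paths not leaving `X`, and `B` the union of the ancestors of `X` along
such paths and the ancestors of `Y` along paths not leaving `M`. Then `X = f b`, `M = F (X, a)` and
`Y = K (M, b)`, where `a`, `b` are the noises on `A`, `B`. By FDR1 no cause influences `Y` except
through `M`, so under `do(s)` the effect is `K (F (s, a), b)`. A common element of `A` and `B`, or a
bidirected arc between them, would give a collider-free m-connecting path forbidden by FDR2 or FDR3
(`not_linked`). Hence `a` and `b` are independent. For independent noises, `F (x, ·)` has law `p(m |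
x)` for almost every `x` (`mapKernel_ae_eq`). The interventional mean of `g(Y)` is therefore the
observational mean of `g(Y) p(M | s) / p(M | X)`, and writing this with the density `p` gives the
formula (`map_eq_withDensity_adjustment`). -/

theorem MeasurableSpace.CountablyGenerated.pi {ι : Type*} [Countable ι] {E : ι → Type*}
    [∀ i, MeasurableSpace (E i)] [h : ∀ i, MeasurableSpace.CountablyGenerated (E i)] :
    MeasurableSpace.CountablyGenerated (∀ i, E i) := by
  have h' : ∀ i, ∃ b : Set (Set (∀ i, E i)), b.Countable ∧
      (inferInstance : MeasurableSpace (E i)).comap (fun f : ∀ i, E i => f i) =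
        MeasurableSpace.generateFrom b := fun i =>
    (MeasurableSpace.CountablyGenerated.comap (fun f : ∀ i, E i => f i)).isCountablyGenerated
  choose b hb hgen using h'
  refine ⟨⟨⋃ i, b i, Set.countable_iUnion hb, ?_⟩⟩
  rw [← MeasurableSpace.iSup_generateFrom]
  exact iSup_congr hgen

/-! ### The adjustment formula for independent noises -/

namespace FDR

variable {𝒳 ℳ 𝒴 : Type*} [MeasurableSpace 𝒳] [MeasurableSpace ℳ] [MeasurableSpace 𝒴]
  {ρX : Measure 𝒳} {ρM : Measure ℳ} {ρY : Measure 𝒴} [SigmaFinite ρX] [SigmaFinite ρM]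
  [SigmaFinite ρY] {p : 𝒳 × ℳ × 𝒴 → ℝ≥0∞}

/-! ### Marginal and conditional densities -/

theorem measurable_densXM (hp : Measurable p) :
    Measurable fun z : 𝒳 × ℳ => densXM ρY p z.1 z.2 := by
  unfold densXM
  exact Measurable.lintegral_prod_right' (f := fun w : (𝒳 × ℳ) × 𝒴 => p (w.1.1, w.1.2, w.2))
    (by fun_prop)

theorem measurable_densX (hp : Measurable p) : Measurable (densX ρM ρY p) := by
  unfold densX
  exact Measurable.lintegral_prod_right' (measurable_densXM hp)

theorem measurable_condM (hp : Measurable p) :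
    Measurable fun z : 𝒳 × ℳ => condM ρM ρY p z.2 z.1 := by
  unfold condM
  exact (measurable_densXM hp).div ((measurable_densX hp).comp measurable_fst)

theorem measurable_densXM_right (hp : Measurable p) (x : 𝒳) :
    Measurable fun m => densXM ρY p x m :=
  (measurable_densXM hp).comp measurable_prodMk_left

theorem measurable_condM_right (hp : Measurable p) (x : 𝒳) :
    Measurable fun m => condM ρM ρY p m x :=
  (measurable_condM hp).comp measurable_prodMk_left

/-- Only an inequality: when `p(x)` is `0` or `∞`, the product with its inverse is `0`. -/
theorem lintegral_condM_le_one (hp : Measurable p) (x : 𝒳) :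
    ∫⁻ m, condM ρM ρY p m x ∂ρM ≤ 1 := by
  simp only [condM, div_eq_mul_inv]
  rw [lintegral_mul_const _ (measurable_densXM_right hp x)]
  exact ENNReal.mul_inv_le_one _

/-- The conditional law of the mediator, as a kernel built from its density. -/
noncomputable def condMKernel (ρM : Measure ℳ) (ρY : Measure 𝒴)
    (p : 𝒳 × ℳ × 𝒴 → ℝ≥0∞) [SigmaFinite ρM] : Kernel 𝒳 ℳ :=
  (Kernel.const 𝒳 ρM).withDensity fun x m => condM ρM ρY p m x

theorem condMKernel_apply (hp : Measurable p) (x : 𝒳) :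
    condMKernel ρM ρY p x = ρM.withDensity fun m => condM ρM ρY p m x := by
  rw [condMKernel, Kernel.withDensity_apply _ (measurable_condM hp), Kernel.const_apply]

theorem isFiniteKernel_condMKernel (hp : Measurable p) :
    IsFiniteKernel (condMKernel ρM ρY p) := by
  refine ⟨1, ENNReal.one_lt_top, fun x => ?_⟩
  rw [condMKernel_apply hp, withDensity_apply _ MeasurableSet.univ, Measure.restrict_univ]
  exact lintegral_condM_le_one hp x

theorem lintegral_density (hp : Measurable p) {g : 𝒳 × ℳ × 𝒴 → ℝ≥0∞} (hg : Measurable g) :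
    ∫⁻ z, g z ∂((ρX.prod (ρM.prod ρY)).withDensity p) =
      ∫⁻ x, ∫⁻ m, ∫⁻ y, p (x, m, y) * g (x, m, y) ∂ρY ∂ρM ∂ρX := by
  rw [lintegral_withDensity_eq_lintegral_mul _ hp hg, lintegral_prod _ (by fun_prop)]
  refine lintegral_congr fun x => ?_
  rw [lintegral_prod _ (by fun_prop)]
  rfl

theorem map_fst_density (hp : Measurable p) :
    ((ρX.prod (ρM.prod ρY)).withDensity p).map Prod.fst = ρX.withDensity (densX ρM ρY p) := by
  refine Measure.ext_of_lintegral _ fun g hg => ?_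
  rw [lintegral_map hg measurable_fst, lintegral_density hp (by fun_prop),
    lintegral_withDensity_eq_lintegral_mul _ (measurable_densX hp) hg]
  refine lintegral_congr fun x => ?_
  rw [Pi.mul_apply, densX, ← lintegral_mul_const _ (measurable_densXM_right hp x)]
  refine lintegral_congr fun m => ?_
  rw [densXM, ← lintegral_mul_const _ (by fun_prop)]

/-- The law of cause and mediator, disintegrated along the conditional density. -/
theorem map_density_eq_compProd (hp : Measurable p)
    (hfin : ∀ᵐ x ∂ρX, densX ρM ρY p x ≠ ∞) :
    ((ρX.prod (ρM.prod ρY)).withDensity p).map (fun z => (z.1, z.2.1)) =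
      (ρX.withDensity (densX ρM ρY p)) ⊗ₘ condMKernel ρM ρY p := by
  have := isFiniteKernel_condMKernel (ρM := ρM) (ρY := ρY) hp
  refine Measure.ext_of_lintegral _ fun g hg => ?_
  rw [lintegral_map hg (by fun_prop), lintegral_density hp (by fun_prop),
    Measure.lintegral_compProd hg, lintegral_withDensity_eq_lintegral_mul _ (measurable_densX hp)
      (Measurable.lintegral_kernel_prod_right' hg)]
  refine lintegral_congr_ae ?_
  filter_upwards [hfin] with x hx
  have hXM := measurable_densXM_right (ρY := ρY) hp x
  have hc := measurable_condM_right (ρM := ρM) (ρY := ρY) hp x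
  rw [Pi.mul_apply, condMKernel_apply hp, lintegral_withDensity_eq_lintegral_mul _ hc (by fun_prop),
    ← lintegral_const_mul _ (by fun_prop)]
  -- Where `p(x) = 0` the quotient `p(m | x)` is meaningless, but `p(x, m)` vanishes for almost all
  -- `m`, so `p(x) p(m | x) = p(x, m)` survives.
  have h0 : densX ρM ρY p x = 0 → ∀ᵐ m ∂ρM, densXM ρY p x m = 0 := fun h =>
    (lintegral_eq_zero_iff hXM).1 h
  have h1 : ∀ᵐ m ∂ρM, densX ρM ρY p x * condM ρM ρY p m x = densXM ρY p x m := by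
    by_cases h : densX ρM ρY p x = 0
    · filter_upwards [h0 h] with m hm
      rw [h, hm, zero_mul]
    · exact Filter.Eventually.of_forall fun m => ENNReal.mul_div_cancel h hx
  refine lintegral_congr_ae ?_
  filter_upwards [h1] with m hm
  rw [Pi.mul_apply, ← mul_assoc, hm, densXM, ← lintegral_mul_const _ (by fun_prop)]

/-! ### The front-door model with two independent noises -/

section Noise

variable {Ω₁ Ω₂ : Type*} [MeasurableSpace Ω₁] [MeasurableSpace Ω₂]
  {α : Measure Ω₁} {δ : Measure Ω₂} [IsProbabilityMeasure α] [IsProbabilityMeasure δ]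
  {f : Ω₂ → 𝒳} {F : 𝒳 × Ω₁ → ℳ} {K : ℳ × Ω₂ → 𝒴}

/-- The law of `F (x, ·)` as a kernel. -/
noncomputable def mapKernel (α : Measure Ω₁) [IsProbabilityMeasure α] (F : 𝒳 × Ω₁ → ℳ) :
    Kernel 𝒳 ℳ :=
  (Kernel.id ×ₖ Kernel.const 𝒳 α).map F

theorem lintegral_mapKernel (hF : Measurable F) (x : 𝒳) {g : ℳ → ℝ≥0∞} (hg : Measurable g) :
    ∫⁻ m, g m ∂mapKernel α F x = ∫⁻ a, g (F (x, a)) ∂α := by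
  rw [mapKernel, Kernel.lintegral_map _ hF _ hg, Kernel.prod_apply, Kernel.id_apply,
    Kernel.const_apply, lintegral_prod (fun z => g (F z)) (by fun_prop),
    lintegral_dirac']
  exact Measurable.lintegral_prod_right' (hg.comp hF)

theorem isMarkovKernel_mapKernel (hF : Measurable F) : IsMarkovKernel (mapKernel α F) :=
  Kernel.IsMarkovKernel.map _ hF

/-- Cause, mediator and effect as functions of the noises: `x = f b`, `m = F (x, a)` and
`y = K (m, b)`. -/
def frontDoorMap (f : Ω₂ → 𝒳) (F : 𝒳 × Ω₁ → ℳ) (K : ℳ × Ω₂ → 𝒴) (n : Ω₁ × Ω₂) : 𝒳 × ℳ × 𝒴 :=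
  (f n.2, F (f n.2, n.1), K (F (f n.2, n.1), n.2))

theorem measurable_frontDoorMap (hf : Measurable f) (hF : Measurable F) (hK : Measurable K) :
    Measurable (frontDoorMap f F K) := by
  unfold frontDoorMap
  fun_prop

/-- For fixed `b` everything depends on `a` only through the mediator, so `a` is integrated out
first; the product form of the noise law is essential. -/
theorem lintegral_map_frontDoorMap (hf : Measurable f) (hF : Measurable F) (hK : Measurable K)
    {g : 𝒳 × ℳ × 𝒴 → ℝ≥0∞} (hg : Measurable g) :
    ∫⁻ z, g z ∂((α.prod δ).map (frontDoorMap f F K)) =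
      ∫⁻ b, ∫⁻ m, g (f b, m, K (m, b)) ∂mapKernel α F (f b) ∂δ := by
  have hΦ := measurable_frontDoorMap hf hF hK
  rw [lintegral_map hg hΦ, lintegral_prod_symm _ (by fun_prop)]
  refine lintegral_congr fun b => ?_
  rw [lintegral_mapKernel hF _ (by fun_prop)]
  rfl

theorem map_fst_frontDoorMap (hf : Measurable f) (hF : Measurable F) (hK : Measurable K) :
    ((α.prod δ).map (frontDoorMap f F K)).map Prod.fst = δ.map f := by
  rw [Measure.map_map measurable_fst (measurable_frontDoorMap hf hF hK)]
  have : Prod.fst ∘ frontDoorMap f F K = f ∘ Prod.snd := rfl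
  rw [this, ← Measure.map_map hf measurable_snd, Measure.map_snd_prod, measure_univ, one_smul]

theorem map_frontDoorMap_eq_compProd (hf : Measurable f) (hF : Measurable F)
    (hK : Measurable K) :
    ((α.prod δ).map (frontDoorMap f F K)).map (fun z => (z.1, z.2.1)) =
      (δ.map f) ⊗ₘ mapKernel α F := by
  have := isMarkovKernel_mapKernel (α := α) hF
  have : IsProbabilityMeasure (δ.map f) := Measure.isProbabilityMeasure_map hf.aemeasurable
  refine Measure.ext_of_lintegral _ fun g hg => ?_
  rw [lintegral_map hg (by fun_prop), lintegral_map_frontDoorMap hf hF hK (by fun_prop),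
    Measure.lintegral_compProd hg, lintegral_map (Measurable.lintegral_kernel_prod_right' hg) hf]

theorem map_eq_density (hf : Measurable f) (hF : Measurable F) (hK : Measurable K)
    (hp : Measurable p)
    (hlaw : (α.prod δ).map (frontDoorMap f F K) = (ρX.prod (ρM.prod ρY)).withDensity p) :
    δ.map f = ρX.withDensity (densX ρM ρY p) := by
  rw [← map_fst_frontDoorMap (α := α) hf hF hK, hlaw, map_fst_density hp]

theorem densX_ne_top (hf : Measurable f) (hF : Measurable F) (hK : Measurable K)
    (hp : Measurable p)
    (hlaw : (α.prod δ).map (frontDoorMap f F K) = (ρX.prod (ρM.prod ρY)).withDensity p) :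
    ∀ᵐ x ∂ρX, densX ρM ρY p x ≠ ∞ := by
  have h := congrArg (fun μ => μ Set.univ) (map_eq_density hf hF hK hp hlaw)
  simp only [Measure.map_apply hf MeasurableSet.univ, Set.preimage_univ, measure_univ,
    withDensity_apply _ MeasurableSet.univ, Measure.restrict_univ] at h
  filter_upwards [ae_lt_top (measurable_densX hp) (h ▸ ENNReal.one_ne_top)] with x hx using hx.ne

/-- The conditional law of the mediator is the law of the mediator under intervention. -/
theorem mapKernel_ae_eq [MeasurableSpace.CountablyGenerated ℳ] (hf : Measurable f)
    (hF : Measurable F) (hK : Measurable K) (hp : Measurable p)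
    (hlaw : (α.prod δ).map (frontDoorMap f F K) = (ρX.prod (ρM.prod ρY)).withDensity p) :
    ∀ᵐ x ∂δ.map f, mapKernel α F x = ρM.withDensity fun m => condM ρM ρY p m x := by
  have := isMarkovKernel_mapKernel (α := α) hF
  have := isFiniteKernel_condMKernel (ρM := ρM) (ρY := ρY) hp
  have : IsProbabilityMeasure (δ.map f) := Measure.isProbabilityMeasure_map hf.aemeasurable
  -- Both kernels disintegrate the law of cause and mediator; as `ℳ` is countably generated, they
  -- agree almost everywhere.
  have h : (δ.map f) ⊗ₘ mapKernel α F = (δ.map f) ⊗ₘ condMKernel ρM ρY p := by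
    rw [← map_frontDoorMap_eq_compProd hf hF hK, hlaw,
      map_density_eq_compProd hp (densX_ne_top hf hF hK hp hlaw),
      map_eq_density hf hF hK hp hlaw]
  filter_upwards [Kernel.ae_eq_of_compProd_eq h] with x hx
  rw [hx, condMKernel_apply hp]

/-- Used from right to left, this turns an integral over effect noise and reference mediator values,
weighted by `p(m | x)`, into an observational mean. -/
theorem lintegral_map_eq_lintegral_condM [MeasurableSpace.CountablyGenerated ℳ]
    (hf : Measurable f) (hF : Measurable F) (hK : Measurable K) (hp : Measurable p)
    (hlaw : (α.prod δ).map (frontDoorMap f F K) = (ρX.prod (ρM.prod ρY)).withDensity p)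
    {g : 𝒳 × ℳ × 𝒴 → ℝ≥0∞} (hg : Measurable g) :
    ∫⁻ z, g z ∂((ρX.prod (ρM.prod ρY)).withDensity p) =
      ∫⁻ n, condM ρM ρY p n.2 (f n.1) * g (f n.1, n.2, K (n.2, n.1)) ∂(δ.prod ρM) := by
  have hc := measurable_condM (ρM := ρM) (ρY := ρY) hp
  rw [← hlaw, lintegral_map_frontDoorMap hf hF hK hg, lintegral_prod]
  · refine lintegral_congr_ae ?_
    filter_upwards [ae_of_ae_map hf.aemeasurable (mapKernel_ae_eq hf hF hK hp hlaw)] with b hb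
    rw [hb, lintegral_withDensity_eq_lintegral_mul _ (measurable_condM_right hp (f b))
      (by fun_prop)]
    rfl
  · exact ((hc.comp (by fun_prop : Measurable fun n : Ω₂ × ℳ => (f n.1, n.2))).mul
      (by fun_prop)).aemeasurable

/-- The front-door adjustment formula for a mediator noise independent of the joint noise of cause
and effect. -/
theorem map_eq_withDensity_adjustment [MeasurableSpace.CountablyGenerated ℳ]
    (hf : Measurable f) (hF : Measurable F) (hK : Measurable K) (hp : Measurable p)
    (hlaw : (α.prod δ).map (frontDoorMap f F K) = (ρX.prod (ρM.prod ρY)).withDensity p) :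
    ∀ᵐ s ∂ρX, Defined ρX ρM ρY p s →
      (α.prod δ).map (fun n => K (F (s, n.1), n.2)) =
        ρY.withDensity (adjustment ρX ρM ρY p s) := by
  have hc := measurable_condM (ρM := ρM) (ρY := ρY) hp
  have hXM := measurable_densXM (ρY := ρY) hp
  have hX := measurable_densX (ρM := ρM) (ρY := ρY) hp
  have hfX := map_eq_density hf hF hK hp hlaw
  have hfin := densX_ne_top hf hF hK hp hlaw
  have hker := mapKernel_ae_eq hf hF hK hp hlaw
  have hprod : (δ.map f).prod ρM = (ρX.prod ρM).withDensity fun z => densX ρM ρY p z.1 := by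
    rw [hfX, prod_withDensity_left hX]
  have hmap : (δ.prod ρM).map (Prod.map f id) = (δ.map f).prod ρM := by
    rw [← Measure.map_prod_map δ ρM hf measurable_id, Measure.map_id]
  have hpos : ∀ᵐ z ∂(δ.map f).prod ρM, densX ρM ρY p z.1 ≠ 0 := by
    rw [hprod, ae_withDensity_iff (by fun_prop)]
    exact Filter.Eventually.of_forall fun _ h => h
  have hfin2 : ∀ᵐ z ∂ρX.prod ρM, densX ρM ρY p z.1 ≠ ∞ :=
    Measure.quasiMeasurePreserving_fst.ae hfin
  have hXMfin : ∀ᵐ z ∂ρX.prod ρM, densXM ρY p z.1 z.2 ≠ ∞ := by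
    have h : ∀ᵐ x ∂ρX, ∀ᵐ m ∂ρM, densXM ρY p x m ≠ ∞ := by
      filter_upwards [hfin] with x hx
      filter_upwards [ae_lt_top (hXM.comp measurable_prodMk_left) hx] with m hm using hm.ne
    exact (Measure.ae_prod_iff_ae_ae
      ((hXM (measurableSet_singleton ∞)).compl)).2 h
  have hac : (δ.map f).prod ρM ≪ ρX.prod ρM := by
    rw [hprod]
    exact withDensity_absolutelyContinuous _ _
  rw [hfX, ae_withDensity_iff hX] at hker
  filter_upwards [hker] with s hs hdef
  have hq := measurable_condM_right (ρM := ρM) (ρY := ρY) hp s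
  -- Positivity from `Defined`: the weight `p(m | s) / p(m | x)` never has a vanishing denominator
  -- where its numerator is nonzero.
  have hsupp : ∀ᵐ n ∂δ.prod ρM, condM ρM ρY p n.2 s ≠ 0 →
      condM ρM ρY p n.2 (f n.1) ≠ 0 ∧ condM ρM ρY p n.2 (f n.1) ≠ ∞ := by
    have h : ∀ᵐ z ∂(δ.map f).prod ρM, condM ρM ρY p z.2 s ≠ 0 →
        condM ρM ρY p z.2 z.1 ≠ 0 ∧ condM ρM ρY p z.2 z.1 ≠ ∞ := by
      filter_upwards [hac hdef.2, hpos, hac hfin2, hac hXMfin] with z h1 h2 h3 h4 h5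
      exact ⟨ENNReal.div_ne_zero.2 ⟨h1 (mul_ne_zero h5 h2), h3⟩, ENNReal.div_ne_top h4 h2⟩
    rw [← hmap] at h
    exact ae_of_ae_map (by fun_prop) h
  have hdens : ∀ᵐ z ∂ρX.prod (ρM.prod ρY), p z ≠ 0 → densX ρM ρY p z.1 ≠ 0 := by
    rw [← ae_withDensity_iff hp]
    refine ae_of_ae_map measurable_fst.aemeasurable (p := fun x => densX ρM ρY p x ≠ 0) ?_
    rw [map_fst_density hp, ae_withDensity_iff hX]
    exact Filter.Eventually.of_forall fun _ h => h
  have hfin3 : ∀ᵐ z ∂ρX.prod (ρM.prod ρY), densX ρM ρY p z.1 ≠ ∞ :=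
    Measure.quasiMeasurePreserving_fst.ae hfin
  refine Measure.ext_of_lintegral _ fun g hg => ?_
  have hc' : Measurable fun z : 𝒳 × ℳ × 𝒴 => condM ρM ρY p z.2.1 z.1 :=
    hc.comp (by fun_prop : Measurable fun z : 𝒳 × ℳ × 𝒴 => (z.1, z.2.1))
  have hq' : Measurable fun z : 𝒳 × ℳ × 𝒴 => condM ρM ρY p z.2.1 s := hq.comp (by fun_prop)
  have hX' : Measurable fun z : 𝒳 × ℳ × 𝒴 => densX ρM ρY p z.1 := hX.comp (by fun_prop)
  have hXM' : Measurable fun z : 𝒳 × ℳ × 𝒴 => densXM ρY p z.1 z.2.1 :=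
    hXM.comp (by fun_prop : Measurable fun z : 𝒳 × ℳ × 𝒴 => (z.1, z.2.1))
  have hG : Measurable fun z : 𝒳 × ℳ × 𝒴 => p z / densXM ρY p z.1 z.2.1 *
      condM ρM ρY p z.2.1 s * densX ρM ρY p z.1 * g z.2.2 :=
    (((hp.div hXM').mul hq').mul hX').mul (by fun_prop)
  calc ∫⁻ y, g y ∂(α.prod δ).map (fun n => K (F (s, n.1), n.2))
      = ∫⁻ b, ∫⁻ m, g (K (m, b)) ∂mapKernel α F s ∂δ := by
        rw [lintegral_map hg (by fun_prop : Measurable fun n : Ω₁ × Ω₂ => K (F (s, n.1), n.2)),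
          lintegral_prod_symm _ (by fun_prop)]
        exact lintegral_congr fun b => (lintegral_mapKernel hF s
          (g := fun m => g (K (m, b))) (by fun_prop)).symm
    _ = ∫⁻ n, condM ρM ρY p n.2 s * g (K (n.2, n.1)) ∂δ.prod ρM := by
        rw [hs hdef.1, lintegral_prod _ (by fun_prop)]
        refine lintegral_congr fun b => ?_
        rw [lintegral_withDensity_eq_lintegral_mul _ hq (by fun_prop)]
        rfl
    -- Change of measure: multiply and divide by `p(m | x)` at the observed cause `x = f b`.
    _ = ∫⁻ n, condM ρM ρY p n.2 (f n.1) * ((condM ρM ρY p n.2 (f n.1))⁻¹ *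
          condM ρM ρY p n.2 s * g (K (n.2, n.1))) ∂δ.prod ρM := by
        refine lintegral_congr_ae ?_
        filter_upwards [hsupp] with n hn
        by_cases h0 : condM ρM ρY p n.2 s = 0
        · simp [h0]
        · obtain ⟨h1, h2⟩ := hn h0
          rw [mul_assoc, ← mul_assoc, ENNReal.mul_inv_cancel h1 h2, one_mul]
    _ = ∫⁻ z, (condM ρM ρY p z.2.1 z.1)⁻¹ * condM ρM ρY p z.2.1 s * g z.2.2
          ∂((ρX.prod (ρM.prod ρY)).withDensity p) :=
        (lintegral_map_eq_lintegral_condM hf hF hK hp hlaw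
          ((hc'.inv.mul hq').mul (hg.comp (measurable_snd.comp measurable_snd)))).symm
    _ = ∫⁻ z, p z / densXM ρY p z.1 z.2.1 * condM ρM ρY p z.2.1 s * densX ρM ρY p z.1 * g z.2.2
          ∂(ρX.prod (ρM.prod ρY)) := by
        rw [lintegral_withDensity_eq_lintegral_mul _ hp (by fun_prop)]
        refine lintegral_congr_ae ?_
        filter_upwards [hdens, hfin3] with z h1 h2
        by_cases h0 : p z = 0
        · simp [h0]
        -- This inversion produces the factor `p(x')` of the formula and turns `p` into `p(y | x',
        -- m)`.
        · have h : (condM ρM ρY p z.2.1 z.1)⁻¹ = densX ρM ρY p z.1 / densXM ρY p z.1 z.2.1 :=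
            ENNReal.inv_div (Or.inl h2) (Or.inl (h1 h0))
          rw [Pi.mul_apply, h, div_eq_mul_inv, div_eq_mul_inv]
          ring
    _ = ∫⁻ x, ∫⁻ m, ∫⁻ y, p (x, m, y) / densXM ρY p x m * condM ρM ρY p m s *
          densX ρM ρY p x * g y ∂ρY ∂ρM ∂ρX := by
        rw [lintegral_prod _ hG.aemeasurable]
        refine lintegral_congr fun x => ?_
        have hGx : Measurable fun w : ℳ × 𝒴 => p (x, w) / densXM ρY p x w.1 *
            condM ρM ρY p w.1 s * densX ρM ρY p x * g w.2 := hG.comp measurable_prodMk_left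
        exact lintegral_prod _ hGx.aemeasurable
    _ = ∫⁻ y, ∫⁻ x, ∫⁻ m, p (x, m, y) / densXM ρY p x m * condM ρM ρY p m s *
          densX ρM ρY p x * g y ∂ρM ∂ρX ∂ρY := by
        have hGs : Measurable fun w : (𝒳 × 𝒴) × ℳ => p (w.1.1, w.2, w.1.2) /
            densXM ρY p w.1.1 w.2 * condM ρM ρY p w.2 s * densX ρM ρY p w.1.1 * g w.1.2 :=
          hG.comp (by fun_prop : Measurable fun w : (𝒳 × 𝒴) × ℳ => (w.1.1, w.2, w.1.2))
        have hswap := lintegral_lintegral_swap (μ := ρX) (ν := ρY) (f := fun x y =>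
          ∫⁻ m, p (x, m, y) / densXM ρY p x m * condM ρM ρY p m s * densX ρM ρY p x * g y ∂ρM)
          (hGs.lintegral_prod_right').aemeasurable
        rw [← hswap]
        refine lintegral_congr fun x => lintegral_lintegral_swap ?_
        have hGx : Measurable fun w : ℳ × 𝒴 => p (x, w) / densXM ρY p x w.1 *
            condM ρM ρY p w.1 s * densX ρM ρY p x * g w.2 := hG.comp measurable_prodMk_left
        exact hGx.aemeasurable
    _ = ∫⁻ y, g y ∂ρY.withDensity (adjustment ρX ρM ρY p s) := by
        have hH : Measurable fun w : (𝒴 × 𝒳) × ℳ =>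
            condY ρY p w.1.1 w.1.2 w.2 * condM ρM ρY p w.2 s * densX ρM ρY p w.1.2 := by
          unfold condY
          exact (((hp.div hXM').mul hq').mul hX').comp (by fun_prop :
              Measurable fun w : (𝒴 × 𝒳) × ℳ => (w.1.2, w.2, w.1.1))
        have hadj : Measurable (adjustment ρX ρM ρY p s) := by
          unfold adjustment
          exact hH.lintegral_prod_right'.lintegral_prod_right'
        rw [lintegral_withDensity_eq_lintegral_mul _ hadj hg]
        refine lintegral_congr fun y => ?_
        have h1 : Measurable fun x => ∫⁻ m, condY ρY p y x m * condM ρM ρY p m s *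
            densX ρM ρY p x ∂ρM := hH.lintegral_prod_right'.comp measurable_prodMk_left
        rw [Pi.mul_apply, adjustment, ← lintegral_mul_const _ h1]
        refine lintegral_congr fun x => ?_
        have h2 : Measurable fun m => condY ρY p y x m * condM ρM ρY p m s *
            densX ρM ρY p x := hH.comp (measurable_prodMk_left (x := (y, x)))
        rw [← lintegral_mul_const _ h2]
        rfl

end Noise

end FDR

/-! ### Connecting walks without colliders -/

namespace ADMG

variable {V : Type u} {G : ADMG V}

namespace Walk

theorem end_mem_support {a b : V} (q : G.Walk a b) : b ∈ q.support := by
  induction q with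
  | nil => simp [support]
  | cons t h q ih => simp [support, ih]

theorem IsOpen.tail {Z : Set V} {a b c : V} {t : Arc} {h : G.Has t a b} {q : G.Walk b c}
    (hq : (cons t h q).IsOpen Z) : q.IsOpen Z := by
  cases q with
  | nil => trivial
  | cons t' h' q => exact hq.2.2

/-- A vertex on an open path is the start of an open path with the same end. -/
theorem exists_suffix {Z : Set V} {a b c : V} (q : G.Walk a b) (hp : q.IsPath) (ho : q.IsOpen Z)
    (hc : c ∈ q.support) :
    ∃ r : G.Walk c b, r.IsPath ∧ r.IsOpen Z ∧ (q.IsDirected → r.IsDirected) := by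
  induction q with
  | nil a =>
    obtain rfl : c = a := by simpa [support] using hc
    exact ⟨nil c, hp, ho, id⟩
  | cons t h q ih =>
    rcases List.mem_cons.1 hc with rfl | hc
    · exact ⟨cons t h q, hp, ho, id⟩
    · obtain ⟨r, h1, h2, h3⟩ := ih (List.nodup_cons.1 hp).2 ho.tail hc
      exact ⟨r, h1, h2, fun hd => h3 hd.2⟩

/-- An arc not creating a collider can be prepended to an open path. -/
theorem IsOpen.cons {Z : Set V} {a b c : V} {t : Arc} {h : G.Has t a b} {q : G.Walk b c}
    (hp : q.IsPath) (ho : q.IsOpen Z) (hb : b ∈ Z → b = c)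
    (hcol : t.HeadAtTarget → q.IsDirected) : (cons t h q).IsOpen Z := by
  cases q with
  | nil => trivial
  | cons t' h' q =>
    -- If the new arc points at `b`, then `q` is directed and its first arc leaves `b`.
    have hno : ¬ (t.HeadAtTarget ∧ t'.HeadAtSource) := by
      rintro ⟨h1, h2⟩
      rw [(hcol h1).1] at h2
      exact h2
    refine ⟨fun hh => absurd hh hno, fun _ hz => ?_, ho⟩
    obtain rfl := hb hz
    exact (List.nodup_cons.1 hp).1 q.end_mem_support

end Walk

/-- Arcs are prepended one at a time; a repeated vertex is handled by passing to the suffix that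
starts there. The first conclusion lets the path be extended further at `d`. -/
theorem exists_directed_open_path {Z : Set V} {d b : V}
    (h : Relation.ReflTransGen (fun u v => G.dir u v ∧ u ∉ Z) d b) :
    (d ∈ Z → d = b) ∧
      ∃ q : G.Walk d b, q.IsPath ∧ q.IsOpen Z ∧ q.IsDirected := by
  induction h using Relation.ReflTransGen.head_induction_on with
  | refl => exact ⟨fun _ => rfl, Walk.nil b, List.nodup_singleton b, trivial, trivial⟩
  | @head u v huv _ ih =>
    refine ⟨fun hu => absurd hu huv.2, ?_⟩
    obtain ⟨hv, q, hp, ho, hd⟩ := ih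
    by_cases hu : u ∈ q.support
    · obtain ⟨r, h1, h2, h3⟩ := q.exists_suffix hp ho hu
      exact ⟨r, h1, h2, h3 hd⟩
    · exact ⟨Walk.cons Arc.fwd huv.1 q, List.nodup_cons.2 ⟨hu, hp⟩,
        Walk.IsOpen.cons hp ho hv fun _ => hd, rfl, hd⟩

/-- m-separated sets are not joined by a trek whose sources avoid the separator. -/
theorem MSep.not_trek {A B Z : Set V} (hsep : G.MSep A B Z) {a b c d : V} (ha : a ∈ A) (hb : b ∈ B)
    (hca : Relation.ReflTransGen (fun u v => G.dir u v ∧ u ∉ Z) c a)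
    (hdb : Relation.ReflTransGen (fun u v => G.dir u v ∧ u ∉ Z) d b)
    (hcd : c = d ∨ G.bi c d) : False := by
  -- The leg from `d` and the bidirected arc come first; the leg to `a` is then traversed backwards,
  -- so no collider arises.
  have key : ∃ q : G.Walk c b, q.IsPath ∧ q.IsOpen Z := by
    obtain ⟨hd, q, hp, ho, hdir⟩ := exists_directed_open_path hdb
    rcases hcd with rfl | hbi
    · exact ⟨q, hp, ho⟩
    · by_cases hc : c ∈ q.support
      · obtain ⟨r, h1, h2, -⟩ := q.exists_suffix hp ho hc
        exact ⟨r, h1, h2⟩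
      · exact ⟨Walk.cons Arc.bi hbi q, List.nodup_cons.2 ⟨hc, hp⟩,
          Walk.IsOpen.cons hp ho hd fun _ => hdir⟩
  suffices ∃ q : G.Walk a b, q.IsPath ∧ q.IsOpen Z by
    obtain ⟨q, hp, ho⟩ := this
    exact hsep a ha b hb q hp ho
  clear ha
  induction hca with
  | refl => exact key
  | @tail u v _ huv ih =>
    obtain ⟨q, hp, ho⟩ := ih
    by_cases hv : v ∈ q.support
    · obtain ⟨r, h1, h2, -⟩ := q.exists_suffix hp ho hv
      exact ⟨r, h1, h2⟩
    · exact ⟨Walk.cons Arc.bwd huv.1 q, List.nodup_cons.2 ⟨hv, hp⟩,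
        Walk.IsOpen.cons hp ho (fun hu => absurd hu huv.2) fun h => h.elim⟩

theorem exists_directed_walk_avoiding {Z : Set V} {a b : V} (hb : b ∉ Z)
    (h : Relation.ReflTransGen (G.deleteOutgoing Z).dir a b) :
    ∃ q : G.Walk a b, q.IsDirected ∧ ∀ v ∈ q.support, v ∉ Z := by
  induction h using Relation.ReflTransGen.head_induction_on with
  | refl => exact ⟨Walk.nil b, trivial, by simpa [Walk.support] using hb⟩
  | head huv _ ih =>
    obtain ⟨q, hd, hq⟩ := ih
    refine ⟨Walk.cons Arc.fwd huv.1 q, ⟨rfl, hd⟩, fun v hv => ?_⟩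
    rcases List.mem_cons.1 hv with rfl | hv
    exacts [huv.2, hq v hv]

/-- Ancestry along directed paths that do not leave the set `S`. -/
theorem mem_ancestors_deleteOutgoing_of_dir {S T : Set V} {a v : V} (h : G.dir a v) (ha : a ∉ S)
    (hv : v ∈ (G.deleteOutgoing S).ancestors T) : a ∈ (G.deleteOutgoing S).ancestors T := by
  obtain ⟨z, hz, hvz⟩ := hv
  exact ⟨z, hz, Relation.ReflTransGen.head ⟨h, ha⟩ hvz⟩

theorem subset_ancestors {T : Set V} : T ⊆ G.ancestors T :=
  fun t ht => ⟨t, ht, Relation.ReflTransGen.refl⟩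

theorem notMem_of_mem_ancestors_deleteOutgoing {S T : Set V} (hST : Disjoint S T) {v : V}
    (hv : v ∈ (G.deleteOutgoing S).ancestors T) : v ∉ S := by
  obtain ⟨z, hz, hvz⟩ := hv
  rcases Relation.ReflTransGen.cases_head hvz with rfl | ⟨w, hvw, -⟩
  exacts [fun h => Set.disjoint_left.1 hST h hz, hvw.2]

/-! ### Separation of the sources of the mediator from those of cause and effect -/

namespace IsFDRTriple

variable {x y : V} {X Y M : Finset V}

/-- The vertices that influence the mediator when the cause is held fixed. -/
def mediatorSources (G : ADMG V) (X M : Finset V) : Set V :=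
  (G.deleteOutgoing (X : Set V)).ancestors M

/-- The vertices that influence the cause, or the effect when the mediator is held fixed. -/
def outerSources (G : ADMG V) (X Y M : Finset V) : Set V :=
  (G.deleteOutgoing (X : Set V)).ancestors X ∪ (G.deleteOutgoing (M : Set V)).ancestors Y

/-- Otherwise a directed path from `X` to `Y` would avoid `M`, against FDR1. -/
theorem notMem_cause_of_mem_effect (h : G.IsFDRTriple x y X Y M) {v : V}
    (hv : v ∈ (G.deleteOutgoing (M : Set V)).ancestors Y) : v ∉ X := by
  intro hvX
  obtain ⟨z, hz, hvz⟩ := hv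
  have hzM : z ∉ (M : Set V) := fun hm => Finset.disjoint_left.1 h.disjoint_YM hz hm
  obtain ⟨q, hd, hq⟩ := exists_directed_walk_avoiding hzM hvz
  obtain ⟨w, hw, hwM⟩ := h.fdr1 v hvX z hz q hd
  exact hq w hw hwM

theorem notMem_cause_of_mem_mediatorSources (h : G.IsFDRTriple x y X Y M) {v : V}
    (hv : v ∈ mediatorSources G X M) : v ∉ X :=
  notMem_of_mem_ancestors_deleteOutgoing (Finset.disjoint_coe.2 h.disjoint_XM) hv

/-- A vertex that influences the mediator does so through its first mediator descendant. -/
theorem exists_first_mediator (h : G.IsFDRTriple x y X Y M) {a : V}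
    (ha : a ∈ mediatorSources G X M) :
    ∃ i ∈ M, Relation.ReflTransGen (fun u v => G.dir u v ∧ u ∉ X ∧ v ∉ X ∧ u ∉ M) a i := by
  obtain ⟨m, hm, ham⟩ := ha
  induction ham using Relation.ReflTransGen.head_induction_on with
  | refl => exact ⟨m, hm, .refl⟩
  | @head u v huv hvm ih =>
    by_cases hu : u ∈ M
    · exact ⟨u, hu, .refl⟩
    · obtain ⟨i, hi, hvi⟩ := ih
      exact ⟨i, hi, .head ⟨huv.1, huv.2, h.notMem_cause_of_mem_mediatorSources ⟨m, hm, hvm⟩, hu⟩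
        hvi⟩

/-- A link would complete a trek between `X` and `M` in the graph without arcs out of `X`. With
empty separator it is connecting, against FDR2. -/
theorem not_linked_cause (h : G.IsFDRTriple x y X Y M) {a b : V}
    (ha : a ∈ mediatorSources G X M) (hb : b ∈ (G.deleteOutgoing (X : Set V)).ancestors X)
    (hab : a = b ∨ G.bi a b) : False := by
  obtain ⟨m, hm, ham⟩ := ha
  obtain ⟨i, hi, hbi⟩ := hb
  refine h.fdr2.not_trek hi hm (c := b) (d := a) (Relation.ReflTransGen.mono (fun u v huv => ⟨huv, id⟩) _ _ hbi)
    (Relation.ReflTransGen.mono (fun u v huv => ⟨huv, id⟩) _ _ ham) ?_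
  rcases hab with rfl | hab
  exacts [.inl rfl, .inr (G.bi_symm _ _ hab)]

/-- FDR3 is applied at the first mediator `i` reached from `a`. Stopping there keeps every arc of
the trek from starting in `M` or touching `X`, so the arcs survive the deletions and their sources
avoid the separator. -/
theorem not_linked_effect (h : G.IsFDRTriple x y X Y M) {a b : V}
    (ha : a ∈ mediatorSources G X M) (hb : b ∈ (G.deleteOutgoing (M : Set V)).ancestors Y)
    (hab : a = b ∨ G.bi a b) : False := by
  have haX := h.notMem_cause_of_mem_mediatorSources ha
  have hbX := h.notMem_cause_of_mem_effect hb
  obtain ⟨i, hi, hai⟩ := h.exists_first_mediator ha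
  obtain ⟨j, hj, hbj⟩ := hb
  have hbj' : Relation.ReflTransGen (fun u v => G.dir u v ∧ u ∉ X ∧ v ∉ X ∧ u ∉ M) b j := by
    clear hab hbX
    induction hbj using Relation.ReflTransGen.head_induction_on with
    | refl => exact .refl
    | @head u v huv hvj ih =>
      exact .head ⟨huv.1, h.notMem_cause_of_mem_effect ⟨j, hj, .head huv hvj⟩,
        h.notMem_cause_of_mem_effect ⟨j, hj, hvj⟩, huv.2⟩ ih
  have hmono : ∀ u v, (G.dir u v ∧ u ∉ X ∧ v ∉ X ∧ u ∉ M) →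
      (((G.deleteIncoming (X : Set V)).deleteOutgoing {i}).dir u v ∧
        u ∉ (X : Set V) ∪ ((M : Set V) \ {i})) := by
    rintro u v ⟨h1, h2, h3, h4⟩
    refine ⟨⟨⟨h1, h3⟩, ?_⟩, ?_⟩
    · rintro rfl
      exact h4 hi
    · rintro (h5 | h5)
      exacts [h2 h5, h4 h5.1]
  refine (h.fdr3 i hi).not_trek (Finset.mem_coe.2 hj) (Set.mem_singleton i) (c := b) (d := a)
    (Relation.ReflTransGen.mono hmono _ _ hbj')
    (Relation.ReflTransGen.mono hmono _ _ hai) ?_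
  rcases hab with rfl | hab
  exacts [.inl rfl, .inr ⟨G.bi_symm _ _ hab, hbX, haX⟩]

theorem not_linked (h : G.IsFDRTriple x y X Y M) {a b : V}
    (ha : a ∈ mediatorSources G X M) (hb : b ∈ outerSources G X Y M)
    (hab : a = b ∨ G.bi a b) : False :=
  hb.elim (fun hb => h.not_linked_cause ha hb hab) fun hb => h.not_linked_effect ha hb hab

theorem disjoint_sources (h : G.IsFDRTriple x y X Y M) :
    Disjoint (mediatorSources G X M) (outerSources G X Y M) :=
  Set.disjoint_left.2 fun _ ha hb => h.not_linked ha hb (.inl rfl)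

end IsFDRTriple

end ADMG

/-! ### Responses to interventions -/

namespace SCM

variable {V : Type u} [Finite V] {G : ADMG V} {E : V → Type e} [∀ v, MeasurableSpace (E v)]
  (𝓜 : SCM.{u, e, w} G E)

theorem response_of_mem {S : Finset V} (s : Vals E S) (n : ∀ v, 𝓜.Noise v) {v : V} (h : v ∈ S) :
    𝓜.response S s n v = s ⟨v, h⟩ := by
  rw [response, WellFounded.fix_eq, dif_pos h]

theorem response_of_notMem {S : Finset V} (s : Vals E S) (n : ∀ v, 𝓜.Noise v) {v : V}
    (h : v ∉ S) :
    𝓜.response S s n v = 𝓜.mech v (fun a => 𝓜.response S s n a) (n v) := by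
  rw [response, WellFounded.fix_eq, dif_neg h]

theorem measurable_response_apply (S : Finset V) (v : V) :
    Measurable fun z : Vals E S × (∀ v, 𝓜.Noise v) => 𝓜.response S z.1 z.2 v := by
  induction v using G.wellFounded_dir.induction with
  | _ v ih =>
    by_cases h : v ∈ S
    · simp only [𝓜.response_of_mem _ _ h]
      exact (measurable_pi_apply (⟨v, h⟩ : S)).comp measurable_fst
    · simp only [𝓜.response_of_notMem _ _ h]
      refine (𝓜.measurable_mech v).comp (Measurable.prodMk ?_ ?_)
      · exact measurable_pi_lambda _ fun a => ih a a.2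
      · exact (measurable_pi_apply v).comp measurable_snd

theorem measurable_response (S : Finset V) :
    Measurable fun z : Vals E S × (∀ v, 𝓜.Noise v) => 𝓜.response S z.1 z.2 :=
  measurable_pi_lambda _ fun v => 𝓜.measurable_response_apply S v

/-- The response of `v` depends only on the noises of a set containing `v` and closed under
taking unfixed parents. -/
theorem response_congr {S : Finset V} (s : Vals E S) {T : Set V}
    (hT : ∀ v ∈ T, v ∉ S → ∀ a, G.dir a v → a ∉ S → a ∈ T) {n n' : ∀ v, 𝓜.Noise v}
    (hn : ∀ v ∈ T, n v = n' v) {v : V} (hv : v ∈ T) :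
    𝓜.response S s n v = 𝓜.response S s n' v := by
  induction v using G.wellFounded_dir.induction with
  | _ v ih =>
    by_cases h : v ∈ S
    · rw [response_of_mem _ _ _ h, response_of_mem _ _ _ h]
    · rw [response_of_notMem _ _ _ h, response_of_notMem _ _ _ h, hn v hv]
      congr 1
      funext a
      by_cases ha : (a : V) ∈ S
      · rw [response_of_mem _ _ _ ha, response_of_mem _ _ _ ha]
      · exact ih a a.2 (hT v hv h a a.2 ha)

/-- Replacing the fixed set by `S'`, with the values taken there, does not change the responses in
a set closed under taking unfixed parents that avoids the old fixed set outside `S'`. -/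
theorem response_consistent {S S' : Finset V} (s : Vals E S) (s' : Vals E S')
    (n : ∀ v, 𝓜.Noise v) (hs : ∀ v : S', s' v = 𝓜.response S s n v) {T : Set V}
    (hTS : ∀ v ∈ T, v ∉ S' → v ∉ S)
    (hT : ∀ v ∈ T, v ∉ S' → ∀ a, G.dir a v → a ∉ S' → a ∈ T) {v : V} (hv : v ∈ T) :
    𝓜.response S' s' n v = 𝓜.response S s n v := by
  induction v using G.wellFounded_dir.induction with
  | _ v ih =>
    by_cases h : v ∈ S'
    · rw [response_of_mem _ _ _ h, hs]
    · rw [response_of_notMem _ _ _ h, response_of_notMem _ _ _ (hTS v hv h)]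
      congr 1
      funext a
      by_cases ha : (a : V) ∈ S'
      · rw [response_of_mem _ _ _ ha, hs]
      · exact ih a a.2 (hT v hv h a a.2 ha)

/-! ### Independent blocks of noise -/

open Classical in
/-- The noise `n`, replaced by the reference noise `d` outside of `A`. -/
noncomputable def overwrite (d : ∀ v, 𝓜.Noise v) (A : Set V) (n : ∀ v, 𝓜.Noise v) :
    ∀ v, 𝓜.Noise v :=
  fun v => if v ∈ A then n v else d v

theorem overwrite_of_mem (d : ∀ v, 𝓜.Noise v) {A : Set V} (n : ∀ v, 𝓜.Noise v) {v : V}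
    (h : v ∈ A) : 𝓜.overwrite d A n v = n v := by
  rw [overwrite, if_pos h]

open Classical in
theorem exists_measurable_overwrite_eq (d : ∀ v, 𝓜.Noise v) (A : Set V) :
    ∃ g : (∀ a : A, 𝓜.Noise a) → ∀ v, 𝓜.Noise v, Measurable g ∧
      𝓜.overwrite d A = g ∘ fun n => A.domRestrict n := by
  refine ⟨fun r v => if h : v ∈ A then r ⟨v, h⟩ else d v, measurable_pi_lambda _ fun v => ?_, ?_⟩
  · by_cases h : v ∈ A
    · simp only [dif_pos h]
      exact measurable_pi_apply (⟨v, h⟩ : A)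
    · simp only [dif_neg h]
      exact measurable_const
  · funext n v
    simp only [overwrite, Function.comp_apply]
    split_ifs <;> rfl

theorem measurable_overwrite (d : ∀ v, 𝓜.Noise v) (A : Set V) :
    Measurable (𝓜.overwrite d A) := by
  obtain ⟨g, hg, h⟩ := 𝓜.exists_measurable_overwrite_eq d A
  rw [h]
  exact hg.comp (measurable_pi_lambda _ fun a => measurable_pi_apply (a : V))

/-- Overwriting factors through restriction, so independence carries over, while both blocks remain
full noise vectors to which responses apply. -/
theorem map_overwrite_prod (d : ∀ v, 𝓜.Noise v) {A B : Set V} (hd : Disjoint A B)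
    (hbi : ∀ a ∈ A, ∀ b ∈ B, ¬ G.bi a b) :
    𝓜.noiseLaw.map (fun n => (𝓜.overwrite d A n, 𝓜.overwrite d B n)) =
      (𝓜.noiseLaw.map (𝓜.overwrite d A)).prod (𝓜.noiseLaw.map (𝓜.overwrite d B)) := by
  rw [← indepFun_iff_map_prod_eq_prod_map_map (𝓜.measurable_overwrite d A).aemeasurable
    (𝓜.measurable_overwrite d B).aemeasurable]
  obtain ⟨g, hg, h⟩ := 𝓜.exists_measurable_overwrite_eq d A
  obtain ⟨g', hg', h'⟩ := 𝓜.exists_measurable_overwrite_eq d B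
  rw [h, h']
  exact (𝓜.noise_indep A B hd hbi).comp hg hg'

theorem measurable_response_right (S : Finset V) (s : Vals E S) : Measurable (𝓜.response S s) :=
  (𝓜.measurable_response S).comp measurable_prodMk_left

open ADMG.IsFDRTriple in
/-- The front-door adjustment formula for a front-door reducible triple. -/
theorem map_doLaw_eq_withDensity_adjustment {x y : V} {X Y M : Finset V}
    (hFDR : G.IsFDRTriple x y X Y M) [∀ v, MeasurableSpace.CountablyGenerated (E v)]
    (ν : ∀ v, Measure (E v)) [∀ v, SigmaFinite (ν v)]
    {p : Vals E X × Vals E M × Vals E Y → ℝ≥0∞} (hobs : 𝓜.HasObsDensity ν X M Y p) :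
    ∀ᵐ s ∂refMeasure ν X,
      FDR.Defined (refMeasure ν X) (refMeasure ν M) (refMeasure ν Y) p s →
      (𝓜.doLaw X s).map Y.restrict = (refMeasure ν Y).withDensity
        (FDR.adjustment (refMeasure ν X) (refMeasure ν M) (refMeasure ν Y) p s) := by
  obtain ⟨hp, hlaw⟩ := hobs
  have : MeasurableSpace.CountablyGenerated (Vals E M) := MeasurableSpace.CountablyGenerated.pi
  have (S : Finset V) : SigmaFinite (refMeasure ν S) := by
    unfold refMeasure
    infer_instance
  obtain ⟨d⟩ : Nonempty (∀ v, 𝓜.Noise v) := nonempty_of_isProbabilityMeasure 𝓜.noiseLaw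
  set A := mediatorSources G X M
  set B := outerSources G X Y M
  set o : Vals E (∅ : Finset V) := fun v => absurd v.2 (Finset.notMem_empty _)
  have hA := 𝓜.measurable_overwrite d A
  have hB := 𝓜.measurable_overwrite d B
  let f : (∀ v, 𝓜.Noise v) → Vals E X := fun n => X.restrict (𝓜.response ∅ o n)
  let F : Vals E X × (∀ v, 𝓜.Noise v) → Vals E M := fun z => M.restrict (𝓜.response X z.1 z.2)
  let K : Vals E M × (∀ v, 𝓜.Noise v) → Vals E Y := fun z => Y.restrict (𝓜.response M z.1 z.2)
  have hf : Measurable f := (Finset.measurable_restrict X).comp (𝓜.measurable_response_right ∅ o)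
  have hF : Measurable F := (Finset.measurable_restrict M).comp (𝓜.measurable_response X)
  have hK : Measurable K := (Finset.measurable_restrict Y).comp (𝓜.measurable_response M)
  have hfB (n) : f (𝓜.overwrite d B n) = f n := by
    funext v
    refine 𝓜.response_congr o (T := (G.deleteOutgoing (X : Set V)).ancestors X) ?_ ?_
      (ADMG.subset_ancestors v.2)
    -- Nothing is fixed here, so parents in `X` count too; they belong to the set trivially.
    · intro v hv _ a hav _
      by_cases ha : a ∈ X
      exacts [ADMG.subset_ancestors ha, ADMG.mem_ancestors_deleteOutgoing_of_dir hav ha hv]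
    · exact fun v hv => 𝓜.overwrite_of_mem d n (.inl hv)
  have hFA (s n) : F (s, 𝓜.overwrite d A n) = F (s, n) := by
    funext v
    exact 𝓜.response_congr s (T := A)
      (fun v hv _ a hav ha => ADMG.mem_ancestors_deleteOutgoing_of_dir hav ha hv)
      (fun v hv => 𝓜.overwrite_of_mem d n hv) (ADMG.subset_ancestors v.2)
  have hKB (m n) : K (m, 𝓜.overwrite d B n) = K (m, n) := by
    funext v
    exact 𝓜.response_congr m (T := (G.deleteOutgoing (M : Set V)).ancestors Y)
      (fun v hv _ a hav ha => ADMG.mem_ancestors_deleteOutgoing_of_dir hav ha hv)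
      (fun v hv => 𝓜.overwrite_of_mem d n (.inr hv)) (ADMG.subset_ancestors v.2)
  -- Consistency: fixing variables at the values they take anyway changes nothing.
  have hobsM (n) : F (f n, n) = M.restrict (𝓜.response ∅ o n) := by
    funext v
    exact 𝓜.response_consistent o (f n) n (fun _ => rfl) (T := Set.univ)
      (fun v _ _ => Finset.notMem_empty v) (fun _ _ _ _ _ _ => trivial) trivial
  have hobsY (n) : K (F (f n, n), n) = Y.restrict (𝓜.response ∅ o n) := by
    rw [hobsM]
    funext v
    exact 𝓜.response_consistent o _ n (fun _ => rfl) (T := Set.univ)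
      (fun v _ _ => Finset.notMem_empty v) (fun _ _ _ _ _ _ => trivial) trivial
  -- FDR1 enters: with `M` held at its values under `do(s)`, the intervention on `X` no longer
  -- matters for `Y`.
  have hdoY (s n) : K (F (s, n), n) = Y.restrict (𝓜.response X s n) := by
    funext v
    exact 𝓜.response_consistent s _ n (fun _ => rfl)
      (T := (G.deleteOutgoing (M : Set V)).ancestors Y)
      (fun v hv _ => hFDR.notMem_cause_of_mem_effect hv)
      (fun v hv _ a hav ha => ADMG.mem_ancestors_deleteOutgoing_of_dir hav ha hv)
      (ADMG.subset_ancestors v.2)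
  have hprod := 𝓜.map_overwrite_prod d (A := A) (B := B) hFDR.disjoint_sources
    fun a ha b hb hab => hFDR.not_linked ha hb (.inr hab)
  have hpα : IsProbabilityMeasure (𝓜.noiseLaw.map (𝓜.overwrite d A)) :=
    Measure.isProbabilityMeasure_map hA.aemeasurable
  have hpδ : IsProbabilityMeasure (𝓜.noiseLaw.map (𝓜.overwrite d B)) :=
    Measure.isProbabilityMeasure_map hB.aemeasurable
  have hlaw' : ((𝓜.noiseLaw.map (𝓜.overwrite d A)).prod
      (𝓜.noiseLaw.map (𝓜.overwrite d B))).map (FDR.frontDoorMap f F K) =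
      ((refMeasure ν X).prod ((refMeasure ν M).prod (refMeasure ν Y))).withDensity p := by
    rw [← hlaw, ← hprod, Measure.map_map (FDR.measurable_frontDoorMap hf hF hK) (hA.prodMk hB),
      obsLaw, doLaw, Measure.map_map (by fun_prop) (𝓜.measurable_response_right ∅ o)]
    congr 1
    funext n
    simp only [Function.comp_apply, FDR.frontDoorMap, hfB, hFA, hKB]
    rw [hobsY, hobsM]
  filter_upwards [FDR.map_eq_withDensity_adjustment hf hF hK hp hlaw'] with s hs hdef
  rw [← hs hdef, ← hprod, Measure.map_map (by fun_prop) (hA.prodMk hB), doLaw,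
    Measure.map_map (Finset.measurable_restrict Y) (𝓜.measurable_response_right X s)]
  congr 1
  funext n
  simp only [Function.comp_apply, hFA, hKB, hdoY]

end SCM

theorem theorem1 {V : Type u} [Finite V] (G : ADMG V) (x y : V) (X Y M : Finset V)
    (hFDR : G.IsFDRTriple x y X Y M)
    (E : V → Type e) [∀ v, MeasurableSpace (E v)] [∀ v, MeasurableSpace.CountablyGenerated (E v)]
    (ν : ∀ v, Measure (E v)) [∀ v, SigmaFinite (ν v)]
    (p : Vals E X × Vals E M × Vals E Y → ℝ≥0∞) :
    -- the adjustment formula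
    (∀ 𝓜 : SCM.{u, e, w} G E, 𝓜.HasObsDensity ν X M Y p →
      ∀ᵐ s ∂refMeasure ν X,
        FDR.Defined (refMeasure ν X) (refMeasure ν M) (refMeasure ν Y) p s →
        (𝓜.doLaw X s).map Y.restrict = (refMeasure ν Y).withDensity
          (FDR.adjustment (refMeasure ν X) (refMeasure ν M) (refMeasure ν Y) p s)) ∧
    -- identifiability
    (∀ (𝓜 : SCM.{u, e, w} G E) (𝓜' : SCM.{u, e, w'} G E), 𝓜.obsLaw = 𝓜'.obsLaw →
      𝓜.HasObsDensity ν X M Y p →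
      ∀ᵐ s ∂refMeasure ν X,
        FDR.Defined (refMeasure ν X) (refMeasure ν M) (refMeasure ν Y) p s →
        (𝓜.doLaw X s).map Y.restrict = (𝓜'.doLaw X s).map Y.restrict) := by
  refine ⟨fun 𝓜 hobs => 𝓜.map_doLaw_eq_withDensity_adjustment hFDR ν hobs,
    fun 𝓜 𝓜' heq hobs => ?_⟩
  -- The formula involves the model only through `p`, which is also a density for the second model.
  have hobs' : 𝓜'.HasObsDensity ν X M Y p := ⟨hobs.1, heq ▸ hobs.2⟩
  filter_upwards [𝓜.map_doLaw_eq_withDensity_adjustment hFDR ν hobs,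
    𝓜'.map_doLaw_eq_withDensity_adjustment hFDR ν hobs'] with s h h' hdef
  rw [h hdef, h' hdef]
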